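/- Let $R\subseteq M_n(\mathbb C)$ be a linear subspace stable under $r\mapsto r^{*}$ (conjugate transpose), and let $\mathcal A$ be the quadratic $*$-algebra generated by hermitian elements $x^1,\dots,x^n$ with relations $\sum_{k,\ell} r_{k\ell}x^kx^\ell=0$ for $r\in R$. Let $R^\perp=\{s\in M_n(\mathbb C):\sum_{k,\ell}s^{k\ell}r_{k\ell}=0\text{ for all } r\in R\}$, so that the Koszul dual $\mathcal A^!$ is generated by the dual basis $\theta_1,\dots,\theta_n$ with relations $\sum_{k,\ell} s^{k\ell}\theta_k\theta_\ell=0$ for $s\in R^\perp$. Assume that $\mathcal A$ corresponds to a noncommutative Euclidean space $\mathbb R^n$: it is a Koszul algebra, it is Artin–Schelter of global dimension $n$ (that is, the trivial left module $\mathbb C$ has projective dimension $n$, $\mathrm{Ext}^i_{\mathcal A}(\mathbb C,\mathcal A)$ is $\mathbb C$ for $i=n$ and $0$ for $i\neq n$, and $\dim\mathcal A_m$ is bounded by a polynomial in $m$), and $\sum_{k=1}^n(x^k)^2$ is central in $\mathcal A$. Let $\mathcal C\ell(\mathcal A)$ be the generalized Clifford algebra of $\mathcal A$, i.e. the unital complex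 $*$-algebra generated by hermitian elements $\Gamma_1,\dots,\Gamma_n$ with relations $\sum_{k,\ell}s^{k\ell}\Gamma_k\Gamma_\ell=\big(\sum_i s^{ii}\big)1$ for $s\in R^\perp$. Then the quadratic relations defining $\mathcal A$ are equivalent to the single identity $\big(\sum_k\Gamma_k x^k\big)^2=1\otimes\sum_p(x^p)^2$ for the $x^k$. That is: in $\mathcal C\ell(\mathcal A)\otimes\mathcal A$ one has $$\Big(\sum_k\Gamma_k\otimes x^k\Big)^2=1\otimes\sum_p(x^p)^2,$$ and for every unital associative complex algebra $\mathcal B$ and all $y^1,\dots,y^n\in\mathcal B$, one has $\sum_{k,\ell}r_{k\ell}\,y^ky^\ell=0$ for all $r\in R$ if and only if $$\Big(\sum_k\Gamma_k\otimes y^k\Big)^2=1\otimes\sum_p(y^p)^2\quad\text{in }\mathcal C\ell(\mathcal A)\otimes\mathcal B.$$ -/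

import Mathlib

open scoped TensorProduct Matrix

noncomputable section

/-! ### Algebras presented by (nonhomogeneous) quadratic relations -/

/-- The element `∑ r_{kl} t_k t_l` of an algebra, for a matrix of coefficients `r` and a family `t`. -/
def quadEval {n : ℕ} {B : Type*} [Ring B] [Algebra ℂ B] (t : Fin n → B)
    (r : Matrix (Fin n) (Fin n) ℂ) : B :=
  ∑ k, ∑ l, r k l • (t k * t l)

/-- The defining relations `∑ r_{kl} t_k t_l = c(r) 1` in the free algebra `ℂ⟨t_1, …, t_n⟩`,
one for each `r` in the space `P` of matrices of coefficients. -/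
inductive QuadRel {n : ℕ} (P : Submodule ℂ (Matrix (Fin n) (Fin n) ℂ))
    (c : Matrix (Fin n) (Fin n) ℂ →ₗ[ℂ] ℂ) :
    FreeAlgebra ℂ (Fin n) → FreeAlgebra ℂ (Fin n) → Prop
  | of (r : Matrix (Fin n) (Fin n) ℂ) (hr : r ∈ P) :
      QuadRel P c (quadEval (FreeAlgebra.ι ℂ) r) (algebraMap ℂ (FreeAlgebra ℂ (Fin n)) (c r))

/-- The unital complex algebra generated by `t_1, …, t_n` with relations
`∑ r_{kl} t_k t_l = c(r) 1` for `r ∈ P`. -/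
def QuadAlg {n : ℕ} (P : Submodule ℂ (Matrix (Fin n) (Fin n) ℂ))
    (c : Matrix (Fin n) (Fin n) ℂ →ₗ[ℂ] ℂ) : Type :=
  RingQuot (QuadRel P c)

namespace QuadAlg

variable {n : ℕ} (P : Submodule ℂ (Matrix (Fin n) (Fin n) ℂ))
  (c : Matrix (Fin n) (Fin n) ℂ →ₗ[ℂ] ℂ)

instance : Ring (QuadAlg P c) := inferInstanceAs (Ring (RingQuot (QuadRel P c)))

instance : Algebra ℂ (QuadAlg P c) := inferInstanceAs (Algebra ℂ (RingQuot (QuadRel P c)))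

/-- The generator `t_k`. -/
def gen (k : Fin n) : QuadAlg P c :=
  RingQuot.mkAlgHom ℂ (QuadRel P c) (FreeAlgebra.ι ℂ k)

variable {P c}

theorem map_quadEval {B C : Type*} [Ring B] [Algebra ℂ B] [Ring C] [Algebra ℂ C]
    (f : B →ₐ[ℂ] C) (t : Fin n → B) (r : Matrix (Fin n) (Fin n) ℂ) :
    f (quadEval t r) = quadEval (fun k => f (t k)) r := by
  simp [quadEval]

/-- The generators satisfy the defining relations. -/
theorem quadEval_gen {r : Matrix (Fin n) (Fin n) ℂ} (hr : r ∈ P) :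
    quadEval (gen P c) r = algebraMap ℂ (QuadAlg P c) (c r) := by
  have h := RingQuot.mkAlgHom_rel ℂ (QuadRel.of (c := c) r hr)
  rw [map_quadEval, AlgHom.commutes] at h
  exact h

/-- The universal property of the presentation: a family satisfying the relations defines a
homomorphism. -/
def lift {B : Type*} [Ring B] [Algebra ℂ B] (y : Fin n → B)
    (hy : ∀ r ∈ P, quadEval y r = algebraMap ℂ B (c r)) : QuadAlg P c →ₐ[ℂ] B :=
  RingQuot.liftAlgHom ℂ ⟨FreeAlgebra.lift ℂ y, by
    rintro _ _ ⟨r, hr⟩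
    rw [map_quadEval, AlgHom.commutes]
    simpa using hy r hr⟩

theorem lift_gen {B : Type*} [Ring B] [Algebra ℂ B] (y : Fin n → B)
    (hy : ∀ r ∈ P, quadEval y r = algebraMap ℂ B (c r)) (k : Fin n) :
    lift y hy (gen P c k) = y k := by
  have h : lift y hy (gen P c k) = FreeAlgebra.lift ℂ y (FreeAlgebra.ι ℂ k) :=
    RingQuot.liftAlgHom_mkAlgHom_apply ..
  simpa using h

theorem hom_ext {B : Type*} [Ring B] [Algebra ℂ B] {f g : QuadAlg P c →ₐ[ℂ] B}
    (h : ∀ k, f (gen P c k) = g (gen P c k)) : f = g := by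
  apply RingQuot.ringQuot_ext'
  ext k
  exact h k

/-! The `*`-structure for which the generators are hermitian. -/

/-- The opposite algebra, on which the scalars act through complex conjugation. -/
def ConjOp (B : Type*) : Type _ := Bᵐᵒᵖ

instance {B : Type*} [Ring B] : Ring (ConjOp B) := inferInstanceAs (Ring Bᵐᵒᵖ)

instance {B : Type*} [Ring B] [Algebra ℂ B] : Algebra ℂ (ConjOp B) :=
  ((algebraMap ℂ Bᵐᵒᵖ).comp (starRingEnd ℂ)).toAlgebra' fun z b =>
    Algebra.commutes (starRingEnd ℂ z) (show Bᵐᵒᵖ from b)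

theorem ConjOp.smul_eq {B : Type*} [Ring B] [Algebra ℂ B] (z : ℂ) (b : Bᵐᵒᵖ) :
    (z • (show ConjOp B from b) : ConjOp B) = (show Bᵐᵒᵖ from star z • b) := by
  rw [Algebra.smul_def (A := Bᵐᵒᵖ)]
  rfl

/-- The adjoint, as a homomorphism to the conjugate opposite algebra. -/
def starHom (hP : ∀ r ∈ P, rᴴ ∈ P) (hc : ∀ r, c rᴴ = star (c r)) :
    QuadAlg P c →ₐ[ℂ] ConjOp (QuadAlg P c) :=
  lift (fun k => (MulOpposite.op (gen P c k) : (QuadAlg P c)ᵐᵒᵖ)) fun r hr => by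
    have h := quadEval_gen (c := c) (hP r hr)
    rw [hc] at h
    have h2 : (algebraMap ℂ (ConjOp (QuadAlg P c)) (c r)) =
        (show (QuadAlg P c)ᵐᵒᵖ from MulOpposite.op (algebraMap ℂ _ (star (c r)))) := rfl
    rw [h2, ← h]
    unfold quadEval
    rw [Finset.sum_comm]
    have key : ∀ k l, (r k l • ((show ConjOp (QuadAlg P c) from MulOpposite.op (gen P c k)) *
        (show ConjOp (QuadAlg P c) from MulOpposite.op (gen P c l))) : ConjOp (QuadAlg P c)) =
        (show (QuadAlg P c)ᵐᵒᵖ from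
          MulOpposite.op (rᴴ l k • (gen P c l * gen P c k))) := by
      intro k l
      exact ConjOp.smul_eq (r k l)
        (MulOpposite.op (gen P c k) * MulOpposite.op (gen P c l))
    have e : (MulOpposite.op (∑ l, ∑ k, rᴴ l k • (gen P c l * gen P c k)) : (QuadAlg P c)ᵐᵒᵖ) =
        ∑ l, ∑ k, MulOpposite.op (rᴴ l k • (gen P c l * gen P c k)) := by
      simp only [Finset.op_sum]
    refine Eq.trans ?_ e.symm
    exact Finset.sum_congr rfl fun l _ => Finset.sum_congr rfl fun k _ => key k l

/-- The antilinear antimultiplicative involution fixing the generators. -/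
def adj (hP : ∀ r ∈ P, rᴴ ∈ P) (hc : ∀ r, c rᴴ = star (c r)) (a : QuadAlg P c) : QuadAlg P c :=
  MulOpposite.unop (show (QuadAlg P c)ᵐᵒᵖ from starHom hP hc a)

section

variable (hP : ∀ r ∈ P, rᴴ ∈ P) (hc : ∀ r, c rᴴ = star (c r))

theorem adj_gen (k : Fin n) : adj hP hc (gen P c k) = gen P c k := by
  have h : starHom hP hc (gen P c k) = _ := lift_gen _ _ k
  rw [adj, h]
  rfl

theorem adj_add (a b : QuadAlg P c) : adj hP hc (a + b) = adj hP hc a + adj hP hc b := by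
  simp only [adj, map_add]
  rfl

theorem adj_mul (a b : QuadAlg P c) : adj hP hc (a * b) = adj hP hc b * adj hP hc a := by
  simp only [adj, map_mul]
  rfl

theorem adj_algebraMap (z : ℂ) :
    adj hP hc (algebraMap ℂ _ z) = algebraMap ℂ (QuadAlg P c) (star z) := by
  simp only [adj, AlgHom.commutes]
  rfl

theorem adj_one : adj hP hc (1 : QuadAlg P c) = 1 := by
  simpa using adj_algebraMap hP hc 1

theorem adj_zero : adj hP hc (0 : QuadAlg P c) = 0 := by
  simpa using adj_algebraMap hP hc 0

theorem adj_smul (z : ℂ) (a : QuadAlg P c) : adj hP hc (z • a) = star z • adj hP hc a := by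
  rw [Algebra.smul_def, adj_mul, adj_algebraMap, Algebra.smul_def, Algebra.commutes]

theorem adj_adj (a : QuadAlg P c) : adj hP hc (adj hP hc a) = a := by
  let φ : QuadAlg P c →ₐ[ℂ] QuadAlg P c :=
    { toFun := fun a => adj hP hc (adj hP hc a)
      map_one' := by rw [adj_one, adj_one]
      map_mul' := fun a b => by rw [adj_mul, adj_mul]
      map_zero' := by rw [adj_zero, adj_zero]
      map_add' := fun a b => by rw [adj_add, adj_add]
      commutes' := fun z => by rw [adj_algebraMap, adj_algebraMap, star_star] }
  have h : φ = AlgHom.id ℂ _ := hom_ext fun k => by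
    show adj hP hc (adj hP hc (gen P c k)) = gen P c k
    rw [adj_gen, adj_gen]
  exact DFunLike.congr_fun h a

/-- The `*`-ring structure for which the generators are hermitian. -/
@[reducible] def starRing : StarRing (QuadAlg P c) where
  star := adj hP hc
  star_involutive := adj_adj hP hc
  star_mul := adj_mul hP hc
  star_add := adj_add hP hc

end

end QuadAlg

/-! ### Quadratic `*`-algebras, their Koszul duals and generalized Clifford algebras -/

/-- The data of a complex quadratic `*`-algebra generated by `n` linearly independent hermitian
elements `x^1, …, x^n`: a space of quadratic relations `∑ r_{kl} x^k x^l = 0`, given by their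
matrices of coefficients `(r_{kl})`, which is stable under the adjoint
`(∑ r_{kl} x^k x^l)^* = ∑ conj(r_{kl}) x^l x^k`. -/
structure QuadStarData (n : ℕ) where
  rel : Submodule ℂ (Matrix (Fin n) (Fin n) ℂ)
  conjTranspose_mem : ∀ r ∈ rel, rᴴ ∈ rel

namespace QuadStarData

variable {n : ℕ} (Q : QuadStarData n)

/-- The quadratic algebra `A = T(E)/(R)`, where `E = ℂ^n` with basis `x^1, …, x^n`. -/
abbrev Alg : Type := QuadAlg Q.rel 0

/-- The coordinates `x^k`. -/
abbrev x (k : Fin n) : Q.Alg := QuadAlg.gen Q.rel 0 k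

instance : StarRing Q.Alg := QuadAlg.starRing Q.conjTranspose_mem (by simp)

instance : StarModule ℂ Q.Alg := ⟨QuadAlg.adj_smul _ _⟩

theorem isSelfAdjoint_x (k : Fin n) : IsSelfAdjoint (Q.x k) := QuadAlg.adj_gen _ _ k

/-- A family `y` in an algebra satisfies the quadratic relations of `A`:
`∑ r_{kl} y^k y^l = 0` for all relations `r` of `A`. -/
def Satisfies {B : Type*} [Ring B] [Algebra ℂ B] (y : Fin n → B) : Prop :=
  ∀ r ∈ Q.rel, quadEval y r = 0

/-- The orthogonal `R^⊥ ⊆ E^* ⊗ E^*` of the space of relations `R ⊆ E ⊗ E`, i.e. the matrices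
`(s^{kl})` with `∑ s^{kl} r_{kl} = 0` for all relations `r` of `A`. -/
def orthogonal : Submodule ℂ (Matrix (Fin n) (Fin n) ℂ) where
  carrier := {s | ∀ r ∈ Q.rel, ∑ k, ∑ l, s k l * r k l = 0}
  zero_mem' := fun r _ => by simp
  add_mem' := fun {s t} hs ht r hr => by
    simp [add_mul, Finset.sum_add_distrib, hs r hr, ht r hr]
  smul_mem' := fun z s hs r hr => by
    simp [mul_assoc, ← Finset.mul_sum, hs r hr]

/-- The Koszul dual `A^! = T(E^*)/(R^⊥)`, generated by the dual basis `θ_k`; its relations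
`∑ s^{kl} θ_k θ_l = 0` are again stable under the adjoint. -/
def dual : QuadStarData n where
  rel := Q.orthogonal
  conjTranspose_mem := fun s hs r hr => by
    have h := congrArg star (hs rᴴ (Q.conjTranspose_mem r hr))
    rw [Finset.sum_comm] at h
    simpa [star_sum, Matrix.conjTranspose_apply] using h

/-- The generalized Clifford algebra `Cℓ(A)`: generators `Γ_k`, and a relation
`∑ s^{kl} Γ_k Γ_l = (∑_i s^{ii}) 1` for every relation `∑ s^{kl} θ_k θ_l = 0` of `A^!`. -/
abbrev Cliff : Type := QuadAlg Q.dual.rel (Matrix.traceLinearMap (Fin n) ℂ ℂ)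

/-- The generators `Γ_k` of the generalized Clifford algebra. -/
abbrev Γ (k : Fin n) : Q.Cliff := QuadAlg.gen Q.dual.rel (Matrix.traceLinearMap (Fin n) ℂ ℂ) k

instance : StarRing Q.Cliff :=
  QuadAlg.starRing Q.dual.conjTranspose_mem (by simp [Matrix.trace_conjTranspose])

instance : StarModule ℂ Q.Cliff := ⟨QuadAlg.adj_smul _ _⟩

theorem isSelfAdjoint_Γ (k : Fin n) : IsSelfAdjoint (Q.Γ k) := QuadAlg.adj_gen _ _ k

/-! ### The Koszul property

`E^{⊗m}` is identified with the space of functions on words `Fin m → Fin n` of length `m`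
(coefficients in the basis `x^{k_1} ⊗ ⋯ ⊗ x^{k_m}`), and `A ⊗ E^{⊗m}` with the `A`-valued functions
on these words. -/

/-- The slice of a tensor at the positions `i, i + 1`, the other indices being those of `u`. -/
def slice (m i : ℕ) (hi : i + 1 < m) (u : Fin m → Fin n) :
    ((Fin m → Fin n) → ℂ) →ₗ[ℂ] Matrix (Fin n) (Fin n) ℂ where
  toFun w := Matrix.of fun k l =>
    w (Function.update (Function.update u ⟨i, Nat.lt_of_succ_lt hi⟩ k) ⟨i + 1, hi⟩ l)
  map_add' _ _ := rfl
  map_smul' _ _ := rfl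

/-- The space `(A^!_m)^* = ⋂_{r+s+2=m} E^{⊗r} ⊗ R ⊗ E^{⊗s} ⊆ E^{⊗m}`
(all of `E^{⊗m}` if `m = 0, 1`). -/
def koszulSpace (m : ℕ) : Submodule ℂ ((Fin m → Fin n) → ℂ) :=
  ⨅ (i : ℕ) (hi : i + 1 < m) (u : Fin m → Fin n), Q.rel.comap (slice m i hi u)

/-- The term `A ⊗ (A^!_m)^* ⊆ A ⊗ E^{⊗m}` of the Koszul complex. -/
def koszulTerm (m : ℕ) : Submodule ℂ ((Fin m → Fin n) → Q.Alg) :=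
  Submodule.span ℂ {f | ∃ (a : Q.Alg), ∃ w ∈ Q.koszulSpace m, f = fun v => w v • a}

/-- The Koszul differential
`b (a ⊗ (x_0 ⊗ x_1 ⊗ ⋯ ⊗ x_m)) = a x_0 ⊗ (x_1 ⊗ ⋯ ⊗ x_m)`. -/
def koszulD (m : ℕ) (f : (Fin (m + 1) → Fin n) → Q.Alg) : (Fin m → Fin n) → Q.Alg :=
  fun v => ∑ k, f (Fin.cons k v) * Q.x k

/-- `A` is a Koszul algebra: its Koszul complex is acyclic in positive degrees. -/
def IsKoszul : Prop :=
  ∀ m, ∀ f ∈ Q.koszulTerm (m + 1), Q.koszulD m f = 0 →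
    ∃ g ∈ Q.koszulTerm (m + 2), Q.koszulD (m + 1) g = f

/-! ### Global dimension, Gorenstein property and polynomial growth -/

/-- The augmentation `ε : A → ℂ`, the projection onto degree zero. -/
def augmentation : Q.Alg →ₐ[ℂ] ℂ := QuadAlg.lift 0 fun r _ => by simp [quadEval]

/-- The trivial left `A`-module `ℂ`. -/
abbrev trivialModule : ModuleCat.{0} Q.Alg :=
  (ModuleCat.restrictScalars (Q.augmentation : Q.Alg →+* ℂ)).obj (ModuleCat.of ℂ ℂ)

/-- `A` has global dimension `d`, i.e. the projective dimension of the trivial module is `d`. -/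
def HasGlobalDimension (d : ℕ) : Prop :=
  CategoryTheory.projectiveDimension Q.trivialModule = d

/-- The Gorenstein property in dimension `d`: `Ext^i_A(ℂ, A)` is `ℂ` if `i = d`,
and vanishes otherwise. -/
def IsGorenstein (d : ℕ) : Prop :=
  ∀ i : ℕ, Module.rank ℂ
    (CategoryTheory.Abelian.Ext Q.trivialModule (ModuleCat.of Q.Alg Q.Alg) i) =
      if i = d then 1 else 0

/-- The homogeneous component `A_m`. -/
def component (m : ℕ) : Submodule ℂ Q.Alg := Submodule.span ℂ (Set.range Q.x) ^ m

/-- `A` has polynomial growth: `dim A_m ≤ C m^N` for some constants and all `m ≥ 1`. -/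
def HasPolynomialGrowth : Prop :=
  ∃ C : ℝ, ∃ N : ℕ, ∀ m : ℕ, 1 ≤ m → (Module.finrank ℂ (Q.component m) : ℝ) ≤ C * (m : ℝ) ^ N

/-- `A` corresponds to a noncommutative Euclidean space `ℝ^n` with orthonormal coordinates `x^k`:
it is Koszul and Artin–Schelter (Gorenstein with polynomial growth) of global dimension `n`, and
`∑ (x^k)²` is central. -/
structure IsNCEuclidean : Prop where
  koszul : Q.IsKoszul
  globalDimension : Q.HasGlobalDimension n
  gorenstein : Q.IsGorenstein n
  polynomialGrowth : Q.HasPolynomialGrowth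
  central : ∑ k, Q.x k ^ 2 ∈ Subalgebra.center ℂ Q.Alg

end QuadStarData

end

/-! If $y$ satisfies the relations, every functional on $\mathcal B$ sends the matrix $(y^ky^l)$
into $R^\perp$. This matrix therefore lies in $R^\perp\otimes\mathcal B$, where the Clifford
identity is the defining relation of $\mathcal C\ell(\mathcal A)$ (`sq_sum_tmul_of_satisfies`).

For the converse, it suffices to find for each $r\in R$ a functional $\varphi$ on $\mathcal
C\ell(\mathcal A)$ with $\varphi(1)=0$ and $\varphi(\Gamma_k\Gamma_l)=r_{kl}$: applying
$\varphi\otimes\mathrm{id}$ to the identity gives $\sum r_{kl}y^ky^l=0$. This is a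
Poincaré–Birkhoff–Witt statement in degree two, proved dually. A functional on $\mathcal
C\ell(\mathcal A)$ is a function $f$ on words with $\sum s^{kl}f(u\,k\,l\,v)=\mathrm{tr}(s)f(uv)$
for $s\in R^\perp$, and $r$ must be extended to such a function length by length.

In a new length the conditions are imposed at positions taken from right to left
(`IsCliffordUpTo.exists_extension`). For a fixed prefix $u$, the defect of the condition at $u$ is
an element of $\mathcal A_2\otimes(\mathcal A^!_j)^*$. For $j>0$ it is a Koszul cycle because
$\sum(x^p)^2$ is central, hence a boundary by Koszulness. The degree-one part of a primitive is the
required correction (`exists_correction`, `IsKoszul.exists_lift`). -/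

section

variable {n : ℕ}

/-! ### Pairing of coefficient matrices and quadratic expressions -/

/-- The bilinear pairing `∑ s^{kl} r_{kl}` of matrices of coefficients. -/
def coeffPairing (n : ℕ) :
    Matrix (Fin n) (Fin n) ℂ →ₗ[ℂ] Matrix (Fin n) (Fin n) ℂ →ₗ[ℂ] ℂ :=
  LinearMap.mk₂ ℂ (fun s r => ∑ k, ∑ l, s k l * r k l)
    (fun s t r => by simp [add_mul, Finset.sum_add_distrib])
    (fun z s r => by simp [mul_assoc, Finset.mul_sum])
    (fun s r t => by simp [mul_add, Finset.sum_add_distrib])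
    (fun z s r => by simp [mul_left_comm, Finset.mul_sum])

theorem coeffPairing_apply (s r : Matrix (Fin n) (Fin n) ℂ) :
    coeffPairing n s r = ∑ k, ∑ l, s k l * r k l := rfl

theorem coeffPairing_one (s : Matrix (Fin n) (Fin n) ℂ) : coeffPairing n s 1 = s.trace := by
  simp [coeffPairing_apply, Matrix.one_apply, Matrix.trace]

/-- Every functional on matrices is the pairing with the matrix of its values on matrix units. -/
theorem coeffPairing_of_dual (φ : Matrix (Fin n) (Fin n) ℂ →ₗ[ℂ] ℂ)
    (r : Matrix (Fin n) (Fin n) ℂ) :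
    coeffPairing n (Matrix.of fun k l => φ (Matrix.single k l 1)) r = φ r := by
  conv_rhs => rw [Matrix.matrix_eq_sum_single r]
  simp only [map_sum, coeffPairing_apply, Matrix.of_apply]
  refine Finset.sum_congr rfl fun k _ => Finset.sum_congr rfl fun l _ => ?_
  rw [show Matrix.single k l (r k l) = r k l • Matrix.single k l (1 : ℂ) by
    simp [Matrix.smul_single], map_smul, smul_eq_mul, mul_comm]

/-- Relations applied at two disjoint positions of a word commute. -/
theorem coeffPairing_swap (s t : Matrix (Fin n) (Fin n) ℂ)
    (h : Fin n → Fin n → Fin n → Fin n → ℂ) :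
    coeffPairing n t (Matrix.of fun i j => coeffPairing n s (Matrix.of fun k l => h k l i j)) =
      coeffPairing n s (Matrix.of fun k l => coeffPairing n t (Matrix.of fun i j => h k l i j)) := by
  have e : (Matrix.of fun i j => coeffPairing n s (Matrix.of fun k l => h k l i j)) =
      ∑ k, ∑ l, s k l • (Matrix.of fun i j => h k l i j) := by
    ext i j
    simp [coeffPairing_apply, Matrix.sum_apply]
  rw [e]
  simp only [map_sum, map_smul, smul_eq_mul]
  rfl

/-- `quadEval` as a linear map in the matrix of coefficients. -/
def quadEvalₗ {B : Type*} [Ring B] [Algebra ℂ B] (t : Fin n → B) :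
    Matrix (Fin n) (Fin n) ℂ →ₗ[ℂ] B where
  toFun := quadEval t
  map_add' r s := by simp [quadEval, add_smul, Finset.sum_add_distrib]
  map_smul' z r := by simp [quadEval, Finset.smul_sum, smul_smul]

theorem quadEvalₗ_apply {B : Type*} [Ring B] [Algebra ℂ B] (t : Fin n → B)
    (r : Matrix (Fin n) (Fin n) ℂ) : quadEvalₗ t r = quadEval t r := rfl

theorem quadEval_one {B : Type*} [Ring B] [Algebra ℂ B] (t : Fin n → B) :
    quadEval t 1 = ∑ p, t p ^ 2 := by
  simp [quadEval, Matrix.one_apply, pow_two]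

theorem coeffPairing_dual_mul {B : Type*} [Ring B] [Algebra ℂ B] (t : Fin n → B)
    (φ : B →ₗ[ℂ] ℂ) (r : Matrix (Fin n) (Fin n) ℂ) :
    coeffPairing n (Matrix.of fun k l => φ (t k * t l)) r = φ (quadEval t r) := by
  simp [coeffPairing_apply, quadEval, mul_comm]

/-! ### Functionals on a quadratic algebra as functions on words -/

namespace QuadAlg

variable {P : Submodule ℂ (Matrix (Fin n) (Fin n) ℂ)} {c : Matrix (Fin n) (Fin n) ℂ →ₗ[ℂ] ℂ}

/-- The functions on words which define functionals on `QuadAlg P c`. -/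
def wordFunctionals (P : Submodule ℂ (Matrix (Fin n) (Fin n) ℂ))
    (c : Matrix (Fin n) (Fin n) ℂ →ₗ[ℂ] ℂ) : Submodule ℂ (List (Fin n) → ℂ) where
  carrier := {f | ∀ r ∈ P, ∀ u v : List (Fin n),
    coeffPairing n r (Matrix.of fun k l => f (u ++ k :: l :: v)) = c r * f (u ++ v)}
  zero_mem' := fun r _ u v => by simp [coeffPairing_apply]
  add_mem' := fun {f g} hf hg r hr u v => by
    have h1 := hf r hr u v
    have h2 := hg r hr u v
    simp only [coeffPairing_apply, Matrix.of_apply, Pi.add_apply, mul_add,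
      Finset.sum_add_distrib] at h1 h2 ⊢
    rw [h1, h2]
  smul_mem' := fun z f hf r hr u v => by
    have h1 := hf r hr u v
    simp only [coeffPairing_apply, Matrix.of_apply, Pi.smul_apply, smul_eq_mul] at h1 ⊢
    simp only [mul_left_comm _ z, ← Finset.mul_sum, h1]

/-- Right translation of functions on words by a letter. -/
def translate (k : Fin n) : Module.End ℂ (wordFunctionals P c) where
  toFun f := ⟨fun w => f.1 (w ++ [k]), fun r hr u v => by
    have h := f.2 r hr u (v ++ [k])
    simpa using h⟩
  map_add' _ _ := rfl
  map_smul' _ _ := rfl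

theorem translate_apply (k : Fin n) (f : wordFunctionals P c) (w : List (Fin n)) :
    (translate k f).1 w = f.1 (w ++ [k]) := rfl

/-- The action of `QuadAlg P c` on functions on words through right translations. -/
def translateHom (P : Submodule ℂ (Matrix (Fin n) (Fin n) ℂ))
    (c : Matrix (Fin n) (Fin n) ℂ →ₗ[ℂ] ℂ) :
    QuadAlg P c →ₐ[ℂ] Module.End ℂ (wordFunctionals P c) :=
  lift translate fun r hr => by
    ext f w
    -- The product of the translations by `k` and `l` sends `f` to `w ↦ f (w ++ [k, l])`, so the
    -- relation is the condition on `f` at the end of the word.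
    have h := f.2 r hr w []
    simp only [List.append_nil, coeffPairing_apply, Matrix.of_apply] at h
    simp only [quadEval, LinearMap.sum_apply, LinearMap.smul_apply, Module.End.mul_apply,
      Submodule.coe_sum, Finset.sum_apply, Submodule.coe_smul, Pi.smul_apply, translate_apply,
      smul_eq_mul, Module.algebraMap_end_apply, List.append_assoc, List.cons_append,
      List.nil_append]
    exact h

/-- The functional on `QuadAlg P c` defined by a function on words. -/
def functional (f : wordFunctionals P c) : QuadAlg P c →ₗ[ℂ] ℂ :=
  -- Evaluating the translated function at the empty word gives `f w` on the monomial of `w`; no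
  -- basis of the algebra is needed.
  LinearMap.proj [] ∘ₗ (wordFunctionals P c).subtype ∘ₗ
    LinearMap.applyₗ f ∘ₗ (translateHom P c).toLinearMap

theorem functional_one (f : wordFunctionals P c) : functional f 1 = f.1 [] := by
  simp [functional]

theorem functional_mul_gen (f : wordFunctionals P c) (a : QuadAlg P c) (k : Fin n) :
    functional f (a * gen P c k) = functional (translate k f) a := by
  simp [functional, translateHom, lift_gen]

theorem functional_gen_mul_gen (f : wordFunctionals P c) (k l : Fin n) :
    functional f (gen P c k * gen P c l) = f.1 [k, l] := by
  rw [functional_mul_gen, ← one_mul (gen P c k), functional_mul_gen, functional_one]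
  rfl

theorem functional_sum_smul {ι : Type*} (s : Finset ι) (z : ι → ℂ)
    (f : ι → wordFunctionals P c) (a : QuadAlg P c) :
    functional (∑ i ∈ s, z i • f i) a = ∑ i ∈ s, z i * functional (f i) a := by
  simp [functional]

end QuadAlg

/-! ### A criterion for membership in $V\otimes M$ -/

/-- A vector-valued function all of whose images under functionals lie in a space `V` of scalar
functions is in the span of the products of vectors with functions in `V`. -/
theorem mem_span_of_forall_dual {ι M : Type*} [Finite ι] [AddCommGroup M] [Module ℂ M]
    (V : Submodule ℂ (ι → ℂ)) (Z : ι → M) (h : ∀ φ : M →ₗ[ℂ] ℂ, (fun i => φ (Z i)) ∈ V) :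
    Z ∈ Submodule.span ℂ {f : ι → M | ∃ a : M, ∃ w ∈ V, f = fun i => w i • a} := by
  classical
  cases nonempty_fintype ι
  obtain ⟨p, hp⟩ := V.subtype.exists_leftInverse_of_injective V.ker_subtype
  -- With `p` a projection onto `V`, this says that $p\otimes\mathrm{id}$ fixes `Z`; it is checked
  -- after applying each functional.
  have key : Z = ∑ j, fun i => (p (Pi.single j 1)).1 i • Z j := by
    funext i
    rw [← sub_eq_zero, ← Module.forall_dual_apply_eq_zero_iff ℂ]
    intro φ
    have h1 : p (fun j => φ (Z j)) = ⟨fun j => φ (Z j), h φ⟩ :=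
      LinearMap.congr_fun hp ⟨fun j => φ (Z j), h φ⟩
    have h2 : (fun j => φ (Z j)) = ∑ j, φ (Z j) • (Pi.single j 1 : ι → ℂ) := by
      funext i
      simp [Finset.sum_apply, Pi.single_apply]
    have h3 := congrArg (fun g : V => g.1 i) h1
    replace h3 : (p (fun j => φ (Z j))).1 i = φ (Z i) := h3
    rw [h2] at h3
    simp only [map_sum, map_smul, Submodule.coe_sum, Finset.sum_apply, Submodule.coe_smul,
      Pi.smul_apply, smul_eq_mul] at h3
    simp only [Finset.sum_apply, map_sub, map_sum, map_smul, smul_eq_mul, sub_eq_zero]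
    rw [← h3]
    exact Finset.sum_congr rfl fun j _ => mul_comm _ _
  rw [key]
  exact Submodule.sum_mem _ fun j _ => Submodule.subset_span ⟨Z j, _, (p (Pi.single j 1)).2, rfl⟩

/-! ### The Clifford identity and the quadratic relations -/

namespace QuadStarData

variable (Q : QuadStarData n)

/-- Biorthogonality $R=R^{\perp\perp}$: a functional that vanishes on $R$ but not at $r$ is the
pairing with an element of $R^\perp$. -/
theorem mem_rel_iff {r : Matrix (Fin n) (Fin n) ℂ} :
    r ∈ Q.rel ↔ ∀ s ∈ Q.orthogonal, coeffPairing n s r = 0 := by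
  refine ⟨fun hr s hs => hs r hr, fun h => ?_⟩
  by_contra hr
  obtain ⟨φ, hφ, hle⟩ := Submodule.exists_le_ker_of_notMem hr
  refine hφ ?_
  rw [← coeffPairing_of_dual φ r]
  refine h _ fun t ht => ?_
  exact (coeffPairing_of_dual φ t).trans (hle ht)

theorem dual_mul_mem_orthogonal {B : Type*} [Ring B] [Algebra ℂ B] {y : Fin n → B}
    (hy : Q.Satisfies y) (φ : B →ₗ[ℂ] ℂ) :
    (Matrix.of fun k l => φ (y k * y l)) ∈ Q.orthogonal := by
  intro r hr
  have h := coeffPairing_dual_mul y φ r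
  rwa [hy r hr, map_zero] at h

theorem satisfies_x : Q.Satisfies Q.x := fun r hr => by
  simpa using QuadAlg.quadEval_gen (c := 0) hr

theorem sq_sum_tmul {B : Type*} [Ring B] [Algebra ℂ B] (y : Fin n → B) :
    (∑ k, Q.Γ k ⊗ₜ[ℂ] y k) ^ 2 = ∑ k, ∑ l, (Q.Γ k * Q.Γ l) ⊗ₜ[ℂ] (y k * y l) := by
  simp [pow_two, Finset.sum_mul_sum]

/-- The Clifford identity holds for every family which satisfies the quadratic relations. -/
theorem sq_sum_tmul_of_satisfies {B : Type*} [Ring B] [Algebra ℂ B] {y : Fin n → B}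
    (hy : Q.Satisfies y) :
    (∑ k, Q.Γ k ⊗ₜ[ℂ] y k) ^ 2 = (1 : Q.Cliff) ⊗ₜ[ℂ] (∑ p, y p ^ 2) := by
  let V : Submodule ℂ (Fin n × Fin n → ℂ) :=
    Q.orthogonal.comap (LinearEquiv.curry ℂ ℂ (Fin n) (Fin n)).toLinearMap
  have hZ := mem_span_of_forall_dual V (fun i => y i.1 * y i.2)
    fun φ => Q.dual_mul_mem_orthogonal hy φ
  -- Both sides are linear in `Z`, and for `Z = w ⊗ a` with `w` in $R^\perp$ this is a defining
  -- relation of the Clifford algebra.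
  have key : ∀ Z ∈ Submodule.span ℂ {f : Fin n × Fin n → B |
      ∃ a : B, ∃ w ∈ V, f = fun i => w i • a},
      ∑ k, ∑ l, (Q.Γ k * Q.Γ l) ⊗ₜ[ℂ] Z (k, l) = (1 : Q.Cliff) ⊗ₜ[ℂ] (∑ p, Z (p, p)) := by
    intro Z hZ
    induction hZ using Submodule.span_induction with
    | mem Z hZ =>
      obtain ⟨a, w, hw, rfl⟩ := hZ
      have h := QuadAlg.quadEval_gen (P := Q.dual.rel)
        (c := Matrix.traceLinearMap (Fin n) ℂ ℂ) (r := fun k l => w (k, l)) hw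
      have h2 := congrArg (fun g : Q.Cliff => g ⊗ₜ[ℂ] a) h
      simp only [quadEval, TensorProduct.sum_tmul, Algebra.algebraMap_eq_smul_one,
        TensorProduct.smul_tmul] at h2
      rw [h2, ← Finset.sum_smul]
      rfl
    | zero => simp
    | add Z Z' _ _ h h' =>
      simp only [Pi.add_apply, TensorProduct.tmul_add, Finset.sum_add_distrib, h, h']
    | smul z Z _ h =>
      simp only [Pi.smul_apply, TensorProduct.tmul_smul, ← Finset.smul_sum, h]
  rw [sq_sum_tmul, key _ hZ]
  simp only [pow_two]

/-- A functional on the Clifford algebra which vanishes on `1` turns the Clifford identity into a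
quadratic relation. -/
theorem quadEval_eq_zero_of_functional {B : Type*} [Ring B] [Algebra ℂ B] {y : Fin n → B}
    (hy : (∑ k, Q.Γ k ⊗ₜ[ℂ] y k) ^ 2 = (1 : Q.Cliff) ⊗ₜ[ℂ] (∑ p, y p ^ 2))
    (φ : Q.Cliff →ₗ[ℂ] ℂ) (h1 : φ 1 = 0) {r : Matrix (Fin n) (Fin n) ℂ}
    (hr : ∀ k l, φ (Q.Γ k * Q.Γ l) = r k l) : quadEval y r = 0 := by
  have h := congrArg ((TensorProduct.lid ℂ B).toLinearMap ∘ₗ φ.rTensor B) hy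
  rw [sq_sum_tmul] at h
  simpa [hr, h1, quadEval] using h

/-! ### Koszul exactness in terms of functions on words -/

/-- Restriction of a function on words to words of length `m`. -/
def ofWords (m : ℕ) (g : List (Fin n) → ℂ) : (Fin m → Fin n) → ℂ := fun v => g (List.ofFn v)

/-- The Koszul conditions in length `m`, for functions on words as lists. -/
theorem ofWords_mem_koszulSpace {m : ℕ} {g : List (Fin n) → ℂ} :
    ofWords m g ∈ Q.koszulSpace m ↔ ∀ a b : List (Fin n), a.length + b.length + 2 = m →
      (Matrix.of fun k l => g (a ++ k :: l :: b)) ∈ Q.rel := by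
  have key : ∀ (u : Fin m → Fin n) (i : ℕ) (hi : i + 1 < m) (k l : Fin n),
      List.ofFn (Function.update (Function.update u ⟨i, Nat.lt_of_succ_lt hi⟩ k) ⟨i + 1, hi⟩ l) =
        (List.ofFn u).take i ++ k :: l :: (List.ofFn u).drop (i + 2) := by
    intro u i hi k l
    apply List.ext_getElem
    · simp
      omega
    · intro j h₁ h₂
      simp only [List.getElem_ofFn, Function.update_apply, Fin.mk.injEq]
      grind
  simp only [koszulSpace, Submodule.mem_iInf, Submodule.mem_comap]
  have hs : ∀ (i : ℕ) (hi : i + 1 < m) (u : Fin m → Fin n),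
      slice m i hi u (ofWords m g) = Matrix.of fun k l =>
        g ((List.ofFn u).take i ++ k :: l :: (List.ofFn u).drop (i + 2)) := by
    intro i hi u
    ext k l
    exact congrArg g (key u i hi k l)
  constructor
  · intro h a b hab
    -- A letter `k₀` is needed to fill the two slots that the slice overwrites; without letters the
    -- matrix is zero.
    rcases isEmpty_or_nonempty (Fin n) with hn | ⟨⟨k₀⟩⟩
    · rw [Subsingleton.elim (Matrix.of _) 0]
      exact zero_mem _
    · obtain rfl : (a ++ k₀ :: k₀ :: b).length = m := by
        simpa [add_assoc] using hab
      have h1 := h a.length (by simp) (a ++ k₀ :: k₀ :: b).get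
      rw [hs, List.ofFn_get] at h1
      simpa using h1
  · intro h i hi u
    rw [hs]
    refine h _ _ ?_
    simp
    omega

/-- Functions on words of fixed length are restrictions of functions on lists. -/
theorem exists_ofWords (m : ℕ) (w : (Fin m → Fin n) → ℂ) : ∃ g, ofWords m g = w :=
  ⟨fun v => if h : v.length = m then w fun i => v.get (i.cast h.symm) else 0, by
    funext v
    simp [ofWords]⟩

/-- Functionals map the terms of the Koszul complex to the spaces `(A^!_m)^*`. -/
theorem dual_comp_mem_koszulSpace {m : ℕ} {Z : (Fin m → Fin n) → Q.Alg}
    (hZ : Z ∈ Q.koszulTerm m) (φ : Q.Alg →ₗ[ℂ] ℂ) : (fun v => φ (Z v)) ∈ Q.koszulSpace m := by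
  induction hZ using Submodule.span_induction with
  | mem Z hZ =>
    obtain ⟨a, w, hw, rfl⟩ := hZ
    convert Submodule.smul_mem _ (φ a) hw using 1
    funext v
    simp [mul_comm]
  | zero =>
    simp only [Pi.zero_apply, map_zero]
    exact zero_mem _
  | add Z Z' _ _ h h' =>
    simp only [Pi.add_apply, map_add]
    exact add_mem h h'
  | smul z Z _ h =>
    simp only [Pi.smul_apply, map_smul]
    exact Submodule.smul_mem _ z h

/-- The function on words which is `z` on the one-letter word `k` and zero on other words. -/
def letterFunctional (k : Fin n) : QuadAlg.wordFunctionals Q.rel 0 :=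
  ⟨fun w => if w = [k] then 1 else 0, fun r _ u v => by
    have : ∀ i j, u ++ i :: j :: v ≠ [k] := fun i j h => by
      have := congrArg List.length h
      simp at this
      omega
    simp [coeffPairing_apply, this]⟩

/-- The function on words given by `s ∈ R^⊥` on two-letter words. -/
def pairFunctional (s : Matrix (Fin n) (Fin n) ℂ) (hs : s ∈ Q.orthogonal) :
    QuadAlg.wordFunctionals Q.rel 0 :=
  ⟨fun w => match w with
    | [k, l] => s k l
    | _ => 0, fun r hr u v => by
    have h := hs r hr
    rcases u with _ | ⟨a, u⟩
    · rcases v with _ | ⟨b, v⟩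
      · simpa [coeffPairing_apply, mul_comm] using h
      · simp [coeffPairing_apply]
    · rcases u with _ | ⟨a', u⟩
      · simp [coeffPairing_apply]
      · rcases u with _ | ⟨a'', u⟩ <;> simp [coeffPairing_apply]⟩

theorem translate_pairFunctional (s : Matrix (Fin n) (Fin n) ℂ) (hs : s ∈ Q.orthogonal)
    (l : Fin n) : QuadAlg.translate l (Q.pairFunctional s hs) =
      ∑ k, s k l • Q.letterFunctional k := by
  ext w
  simp only [QuadAlg.translate_apply, Submodule.coe_sum, Submodule.coe_smul, Finset.sum_apply,
    Pi.smul_apply, smul_eq_mul, pairFunctional, letterFunctional]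
  rcases w with _ | ⟨a, _ | ⟨b, w⟩⟩
  · simp
  · simp
  · rcases w with _ | ⟨b', w⟩ <;> simp

/-- Only the degree-one part of `a` contributes to the degree-two part of `a * Q.x l`. -/
theorem pairFunctional_mul_x (s : Matrix (Fin n) (Fin n) ℂ) (hs : s ∈ Q.orthogonal)
    (a : Q.Alg) (l : Fin n) :
    QuadAlg.functional (Q.pairFunctional s hs) (a * Q.x l) =
      ∑ k, s k l * QuadAlg.functional (Q.letterFunctional k) a := by
  rw [QuadAlg.functional_mul_gen, translate_pairFunctional, QuadAlg.functional_sum_smul]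

theorem pairFunctional_quadEval (s : Matrix (Fin n) (Fin n) ℂ) (hs : s ∈ Q.orthogonal)
    (r : Matrix (Fin n) (Fin n) ℂ) :
    QuadAlg.functional (Q.pairFunctional s hs) (quadEval Q.x r) = coeffPairing n s r := by
  rw [← coeffPairing_dual_mul]
  simp only [QuadAlg.functional_gen_mul_gen]
  rfl

/-- Exactness of the Koszul complex at `A_2 ⊗ (A^!_j)^*`, in terms of functions on words. -/
theorem IsKoszul.exists_lift {Q : QuadStarData n} (hQ : Q.IsKoszul) (j : ℕ)
    (M : List (Fin n) → Matrix (Fin n) (Fin n) ℂ)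
    (hM : ∀ s ∈ Q.orthogonal, ∀ a b : List (Fin n), a.length + b.length + 2 = j →
      (Matrix.of fun k l => coeffPairing n s (M (a ++ k :: l :: b))) ∈ Q.rel)
    (hd : ∀ v : List (Fin n), v.length + 1 = j → ∑ m, quadEval Q.x (M (m :: v)) * Q.x m = 0) :
    ∃ c : List (Fin n) → ℂ,
      (∀ a b : List (Fin n), a.length + b.length = j → a ≠ [] →
        (Matrix.of fun k l => c (a ++ k :: l :: b)) ∈ Q.rel) ∧
      ∀ v : List (Fin n), v.length = j → ∀ s ∈ Q.orthogonal,
        coeffPairing n s (Matrix.of fun k l => c (k :: l :: v)) = coeffPairing n s (M v) := by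
  rcases j with _ | j
  -- For `j = 0` the first condition is vacuous, and `M []` itself serves as `c`; exactness is
  -- needed only for `j > 0`.
  · refine ⟨fun w => match w with
      | [k, l] => M [] k l
      | _ => 0, fun a b hab ha => absurd (List.length_eq_zero_iff.1 (by omega)) ha, ?_⟩
    intro v hv s _
    rw [List.length_eq_zero_iff.1 hv]
    rfl
  · let Z : (Fin (j + 1) → Fin n) → Q.Alg := fun v => quadEval Q.x (M (List.ofFn v))
    have hZ : Z ∈ Q.koszulTerm (j + 1) := by
      refine mem_span_of_forall_dual _ Z fun φ => ?_
      have h1 : (fun v => φ (Z v)) = ofWords (j + 1) fun w =>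
          coeffPairing n (Matrix.of fun k l => φ (Q.x k * Q.x l)) (M w) := by
        funext v
        exact (coeffPairing_dual_mul _ _ _).symm
      rw [h1, ofWords_mem_koszulSpace]
      exact fun a b hab => hM _ (Q.dual_mul_mem_orthogonal Q.satisfies_x φ) a b hab
    have hdZ : Q.koszulD j Z = 0 := by
      funext v
      simpa [koszulD, Z, List.ofFn_cons] using hd (List.ofFn v) (by simp)
    obtain ⟨Y, hY, hYZ⟩ := hQ j Z hZ hdZ
    -- The primitive `Y` need not be homogeneous. Its degree-one part suffices, since the
    -- differential raises the degree in `A` by one.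
    choose c hc using fun k => exists_ofWords (j + 2)
      fun v => QuadAlg.functional (Q.letterFunctional k) (Y v)
    refine ⟨fun w => match w with
      | [] => 0
      | k :: w => c k w, ?_, ?_⟩
    · intro a b hab ha
      obtain ⟨k, a, rfl⟩ := List.exists_cons_of_ne_nil ha
      have h := Q.dual_comp_mem_koszulSpace hY (QuadAlg.functional (Q.letterFunctional k))
      rw [← hc, ofWords_mem_koszulSpace] at h
      exact h a b (by simp at hab; omega)
    · intro v hv s hs
      obtain ⟨v, rfl⟩ : ∃ u : Fin (j + 1) → Fin n, List.ofFn u = v := by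
        rw [← hv]
        exact ⟨v.get, List.ofFn_get v⟩
      have h := congrArg (QuadAlg.functional (Q.pairFunctional s hs)) (congrFun hYZ v)
      have h2 : ∀ k l, c k (l :: List.ofFn v) =
          QuadAlg.functional (Q.letterFunctional k) (Y (Fin.cons l v)) := by
        intro k l
        have := congrFun (hc k) (Fin.cons l v)
        simpa [ofWords, List.ofFn_cons] using this
      simp only [koszulD, map_sum, pairFunctional_mul_x, Z, pairFunctional_quadEval] at h
      rw [← h, Finset.sum_comm]
      simp only [coeffPairing_apply, Matrix.of_apply, h2]

/-- The quadratic expressions in a family satisfying the relations only depend on the coefficients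
modulo the relations. -/
theorem Satisfies.quadEval_congr {Q : QuadStarData n} {B : Type*} [Ring B] [Algebra ℂ B]
    {y : Fin n → B} (hy : Q.Satisfies y) {r r' : Matrix (Fin n) (Fin n) ℂ}
    (h : ∀ s ∈ Q.orthogonal, coeffPairing n s r = coeffPairing n s r') :
    quadEval y r = quadEval y r' := by
  have h1 := hy (r - r') (Q.mem_rel_iff.2 fun s hs => by rw [map_sub, h s hs, sub_self])
  rwa [← quadEvalₗ_apply, map_sub, sub_eq_zero] at h1

/-! ### Extension of Clifford functionals length by length -/

/-- The conditions for a function on words to define a functional on the Clifford algebra, in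
lengths at most `N`. -/
def IsCliffordUpTo (N : ℕ) (f : List (Fin n) → ℂ) : Prop :=
  ∀ s ∈ Q.orthogonal, ∀ u v : List (Fin n), u.length + v.length + 2 ≤ N →
    coeffPairing n s (Matrix.of fun k l => f (u ++ k :: l :: v)) = s.trace * f (u ++ v)

variable {Q}

/-- If the Clifford conditions in length `N + 1` hold after prefixes longer than `u`, they can be
corrected so as to hold after `u`. -/
theorem exists_correction (hK : Q.IsKoszul) (hC : ∑ k, Q.x k ^ 2 ∈ Subalgebra.center ℂ Q.Alg)
    {N : ℕ} {f g : List (Fin n) → ℂ} (hf : Q.IsCliffordUpTo N f) (u : List (Fin n)) (j : ℕ)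
    (hj : u.length + j + 1 = N)
    (hg : ∀ s ∈ Q.orthogonal, ∀ u' v : List (Fin n), u.length + 1 ≤ u'.length →
      u'.length + v.length + 1 = N →
      coeffPairing n s (Matrix.of fun k l => g (u' ++ k :: l :: v)) = s.trace * f (u' ++ v)) :
    ∃ c : List (Fin n) → ℂ,
      (∀ a b : List (Fin n), a.length + b.length = j → a ≠ [] →
        (Matrix.of fun k l => c (a ++ k :: l :: b)) ∈ Q.rel) ∧
      ∀ v : List (Fin n), v.length = j → ∀ s ∈ Q.orthogonal,
        coeffPairing n s (Matrix.of fun k l => g (u ++ k :: l :: v) + c (k :: l :: v)) =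
          s.trace * f (u ++ v) := by
  -- Pairing this matrix with `s` measures the defect of the condition after `u`. The correction `c`
  -- must have the same pairings.
  have hsplit : ∀ s v, coeffPairing n s
      (f (u ++ v) • 1 - Matrix.of fun k l => g (u ++ k :: l :: v)) =
      s.trace * f (u ++ v) - coeffPairing n s (Matrix.of fun k l => g (u ++ k :: l :: v)) := by
    intro s v
    rw [map_sub, map_smul, coeffPairing_one, smul_eq_mul, mul_comm]
  refine Exists.imp (fun c hc => ⟨hc.1, fun v hv s hs => ?_⟩) (hK.exists_lift j
    (fun v => f (u ++ v) • 1 - Matrix.of fun k l => g (u ++ k :: l :: v)) ?_ ?_)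
  · have h := hc.2 v hv s hs
    rw [hsplit] at h
    rw [← eq_sub_iff_add_eq'.1 h, ← map_add]
    rfl
  -- The defect satisfies the Koszul conditions: imposing `s` after `u` and `t` further right in
  -- either order gives `s.trace * t.trace * f (u ++ a ++ b)`.
  · intro s hs a b hab
    rw [mem_rel_iff]
    intro t ht
    have h1 := hf t ht (u ++ a) b (by simp; omega)
    have h2 := fun k l => hg t ht (u ++ k :: l :: a) b (by simp) (by simp; omega)
    have h3 := hf s hs u (a ++ b) (by simp; omega)
    simp only [hsplit]
    have h4 : coeffPairing n t (Matrix.of fun k' l' => coeffPairing n s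
        (Matrix.of fun k l => g (u ++ k :: l :: (a ++ k' :: l' :: b)))) =
        coeffPairing n s (Matrix.of fun k l => coeffPairing n t
          (Matrix.of fun k' l' => g ((u ++ k :: l :: a) ++ k' :: l' :: b))) := by
      rw [coeffPairing_swap]
      simp only [List.append_assoc, List.cons_append]
    have h5 : (Matrix.of fun k' l' => s.trace * f (u ++ (a ++ k' :: l' :: b)) -
        coeffPairing n s (Matrix.of fun k l => g (u ++ k :: l :: (a ++ k' :: l' :: b)))) =
        s.trace • (Matrix.of fun k' l' => f ((u ++ a) ++ k' :: l' :: b)) -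
        Matrix.of fun k' l' => coeffPairing n s
          (Matrix.of fun k l => g (u ++ k :: l :: (a ++ k' :: l' :: b))) := by
      ext
      simp
    have h6 : (Matrix.of fun k l => t.trace * f ((u ++ k :: l :: a) ++ b)) =
        t.trace • Matrix.of fun k l => f (u ++ k :: l :: (a ++ b)) := by
      ext
      simp
    rw [h5, map_sub, map_smul, h1, h4]
    simp only [h2]
    rw [h6, map_smul, h3, smul_eq_mul, smul_eq_mul, List.append_assoc]
    ring
  -- The defect is a cycle. Centrality turns its `f` part into $\sum_m
  -- f(u\,m\,v)\,x^m\sum_p(x^p)^2$. The `g` part, bracketed as $x^k(x^lx^m)$, equals the same sum by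
  -- the conditions after the prefixes `u ++ [k]`.
  · intro v hv
    have h1 : ∀ k, quadEval Q.x (Matrix.of fun l m => g (u ++ k :: l :: m :: v)) =
        f (u ++ k :: v) • ∑ p, Q.x p ^ 2 := by
      intro k
      rw [← quadEval_one, ← quadEvalₗ_apply Q.x 1, ← map_smul, quadEvalₗ_apply]
      refine Q.satisfies_x.quadEval_congr fun s hs => ?_
      have h := hg s hs (u ++ [k]) v (by simp) (by simp; omega)
      rw [map_smul, coeffPairing_one, smul_eq_mul, mul_comm]
      simpa using h
    have h2 : ∀ m, quadEval Q.x (f (u ++ m :: v) • 1 -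
        Matrix.of fun k l => g (u ++ k :: l :: m :: v)) * Q.x m =
        Q.x m * (f (u ++ m :: v) • ∑ p, Q.x p ^ 2) -
          ∑ k, ∑ l, g (u ++ k :: l :: m :: v) • (Q.x k * (Q.x l * Q.x m)) := by
      intro m
      rw [← quadEvalₗ_apply, map_sub, map_smul, quadEvalₗ_apply, quadEval_one, quadEvalₗ_apply,
        sub_mul, smul_mul_assoc, mul_smul_comm, (Subalgebra.mem_center_iff.1 hC (Q.x m))]
      simp [quadEval, Finset.sum_mul, mul_assoc]
    simp only [h2, Finset.sum_sub_distrib, ← h1]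
    rw [Finset.sum_comm, sub_eq_zero]
    refine Finset.sum_congr rfl fun k _ => ?_
    rw [Finset.sum_comm]
    simp [quadEval, Finset.mul_sum]

/-- Functions on words satisfying the Clifford conditions up to length `N` extend to length
`N + 1`. -/
theorem IsCliffordUpTo.exists_extension (hK : Q.IsKoszul)
    (hC : ∑ k, Q.x k ^ 2 ∈ Subalgebra.center ℂ Q.Alg) {N : ℕ} {f : List (Fin n) → ℂ}
    (hf : Q.IsCliffordUpTo N f) :
    ∃ g, Q.IsCliffordUpTo (N + 1) g ∧ ∀ w : List (Fin n), w.length ≤ N → g w = f w := by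
  have key : ∀ d p, p + d = N → ∃ g : List (Fin n) → ℂ, ∀ s ∈ Q.orthogonal,
      ∀ u v : List (Fin n), p ≤ u.length → u.length + v.length + 1 = N →
      coeffPairing n s (Matrix.of fun k l => g (u ++ k :: l :: v)) = s.trace * f (u ++ v) := by
    intro d
    induction d with
    -- At `p = N` no pair of letters starts that far right in a word of length `N + 1`.
    | zero => exact fun p hp => ⟨0, fun s _ u v h h' => by omega⟩
    | succ j ih =>
      intro p hp
      obtain ⟨g, hg⟩ := ih (p + 1) (by omega)
      have hc : ∀ u : List (Fin n), ∃ c : List (Fin n) → ℂ, u.length = p →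
          (∀ a b : List (Fin n), a.length + b.length = j → a ≠ [] →
            (Matrix.of fun k l => c (a ++ k :: l :: b)) ∈ Q.rel) ∧
          ∀ v : List (Fin n), v.length = j → ∀ s ∈ Q.orthogonal,
            coeffPairing n s (Matrix.of fun k l => g (u ++ k :: l :: v) + c (k :: l :: v)) =
              s.trace * f (u ++ v) := by
        intro u
        by_cases hu : u.length = p
        · obtain ⟨c, hc⟩ := exists_correction hK hC hf u j (by omega) (by rwa [hu])
          exact ⟨c, fun _ => hc⟩
        · exact ⟨0, fun h => absurd h hu⟩
      choose c hc using hc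
      -- Each prefix of length `p` has its own correction. Beyond position `p` its slices lie in
      -- $R$, so conditions already achieved persist.
      refine ⟨fun w => g w + c (w.take p) (w.drop p), fun s hs u v hu huv => ?_⟩
      obtain ⟨u, a, rfl, hup⟩ : ∃ u₁ a : List (Fin n), u = u₁ ++ a ∧ u₁.length = p :=
        ⟨u.take p, u.drop p, (List.take_append_drop p u).symm, by simpa using hu⟩
      obtain ⟨hc₁, hc₂⟩ := hc u hup
      have htd : ∀ w, (u ++ w).take p = u ∧ (u ++ w).drop p = w := by
        intro w
        subst hup
        simp
      simp only [List.append_assoc, (htd _).1, (htd _).2]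
      rw [List.length_append] at huv
      rcases eq_or_ne a [] with rfl | ha
      · exact hc₂ v (by simp at huv; omega) s hs
      · have h1 := hc₁ a v (by omega) ha
        have h2 := hg s hs (u ++ a) v
          (by have := List.length_pos_iff.2 ha; simp; omega) (by simp; omega)
        have h3 := Q.mem_rel_iff.1 h1 s hs
        simp only [List.append_assoc] at h2
        rw [← h2, ← add_zero (coeffPairing n s (Matrix.of fun k l => g _)), ← h3, ← map_add]
        rfl
  obtain ⟨g, hg⟩ := key N 0 (zero_add N)
  refine ⟨fun w => if w.length ≤ N then f w else g w, fun s hs u v huv => ?_,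
    fun w hw => if_pos hw⟩
  have h1 : ∀ k l : Fin n, (u ++ k :: l :: v).length = u.length + v.length + 2 := by
    intro k l
    simp
    omega
  have h2 : (u ++ v).length ≤ N := by
    simp
    omega
  simp only [h1, h2, if_true]
  split_ifs with h
  · exact hf s hs u v h
  · exact hg s hs u v (Nat.zero_le _) (by omega)

/-- For a relation `r` of `A` there is a functional on the Clifford algebra which vanishes on `1`
and has the value `r_{kl}` on `Γ_k Γ_l`. -/
theorem exists_functional (hK : Q.IsKoszul) (hC : ∑ k, Q.x k ^ 2 ∈ Subalgebra.center ℂ Q.Alg)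
    {r : Matrix (Fin n) (Fin n) ℂ} (hr : r ∈ Q.rel) :
    ∃ φ : Q.Cliff →ₗ[ℂ] ℂ, φ 1 = 0 ∧ ∀ k l, φ (Q.Γ k * Q.Γ l) = r k l := by
  let f₀ : List (Fin n) → ℂ := fun w => match w with
    | [k, l] => r k l
    | _ => 0
  have h₀ : Q.IsCliffordUpTo 2 f₀ := by
    intro s hs u v huv
    obtain ⟨hu, hv⟩ : u.length = 0 ∧ v.length = 0 := by omega
    obtain rfl := List.length_eq_zero_iff.1 hu
    obtain rfl := List.length_eq_zero_iff.1 hv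
    have h : s.trace * f₀ ([] ++ []) = 0 := mul_zero _
    rw [h]
    exact hs r hr
  choose! ext hext₁ hext₂ using fun (N : ℕ) (f : List (Fin n) → ℂ)
    (hf : Q.IsCliffordUpTo N f) => hf.exists_extension hK hC
  -- `F N` satisfies the conditions up to length `N + 2` and agrees with its successors there. Hence
  -- `w ↦ F w.length w` is the common extension.
  let F : ℕ → List (Fin n) → ℂ := fun N => Nat.rec f₀ (fun N f => ext (N + 2) f) N
  have hF : ∀ N, Q.IsCliffordUpTo (N + 2) (F N) := by
    intro N
    induction N with
    | zero => exact h₀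
    | succ N ih => exact hext₁ _ _ ih
  have hstab : ∀ (w : List (Fin n)) (N d : ℕ), w.length ≤ N + 2 → F (N + d) w = F N w := by
    intro w N d hw
    induction d with
    | zero => rfl
    | succ d ih => exact (hext₂ _ _ (hF (N + d)) w (by omega)).trans ih
  have hlim : ∀ (w : List (Fin n)) (N : ℕ), w.length ≤ N → F w.length w = F N w := by
    intro w N hw
    obtain ⟨d, rfl⟩ := Nat.exists_eq_add_of_le hw
    exact (hstab w _ d (by omega)).symm
  let G : QuadAlg.wordFunctionals Q.dual.rel (Matrix.traceLinearMap (Fin n) ℂ ℂ) :=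
    ⟨fun w => F w.length w, fun s hs u v => by
      have h := hF (u.length + v.length + 2) s hs u v (by omega)
      have h1 : ∀ k l, F (u ++ k :: l :: v).length (u ++ k :: l :: v) =
          F (u.length + v.length + 2) (u ++ k :: l :: v) :=
        fun k l => hlim (u ++ k :: l :: v) (u.length + v.length + 2) (by simp; omega)
      have h2 : F (u ++ v).length (u ++ v) = F (u.length + v.length + 2) (u ++ v) :=
        hlim (u ++ v) (u.length + v.length + 2) (by simp)
      change coeffPairing n s (Matrix.of fun k l =>
        F (u ++ k :: l :: v).length (u ++ k :: l :: v)) = s.trace * F (u ++ v).length (u ++ v)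
      rw [h2]
      refine Eq.trans (congrArg _ ?_) h
      ext k l
      exact h1 k l⟩
  refine ⟨QuadAlg.functional G, QuadAlg.functional_one G, fun k l => ?_⟩
  rw [QuadAlg.functional_gen_mul_gen]
  -- `G` evaluates `[k, l]` through `F 2`, which still agrees with `f₀` on words of length at most
  -- two.
  exact hstab [k, l] 0 2 (by simp)

end QuadStarData

end

theorem corollary2p4 {n : ℕ} (Q : QuadStarData n) (hQ : Q.IsNCEuclidean) :
    (∑ k, Q.Γ k ⊗ₜ[ℂ] Q.x k) ^ 2 = (1 : Q.Cliff) ⊗ₜ[ℂ] (∑ p, Q.x p ^ 2) ∧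
    ∀ (B : Type*) [Ring B] [Algebra ℂ B] (y : Fin n → B),
      Q.Satisfies y ↔
        (∑ k, Q.Γ k ⊗ₜ[ℂ] y k) ^ 2 = (1 : Q.Cliff) ⊗ₜ[ℂ] (∑ p, y p ^ 2) := by
  refine ⟨Q.sq_sum_tmul_of_satisfies Q.satisfies_x, fun B _ _ y =>
    ⟨Q.sq_sum_tmul_of_satisfies, fun hy r hr => ?_⟩⟩
  obtain ⟨φ, h1, hφ⟩ := QuadStarData.exists_functional hQ.koszul hQ.central hr
  exact Q.quadEval_eq_zero_of_functional hy φ h1 hφ
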